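/- **Setting.** Let $F\in\mathbb R^{n\times n}$, $H_i\in\mathbb R^{m_i\times n}$ and $R_i\in\mathbb R^{m_i\times m_i}$ for $i=1,\dots,N$. Let $H=[H_1;\dots;H_N]$, let $\bar R=\operatorname{diag}\{R_1,\dots,R_N\}$ be symmetric positive definite, and let $Q\in\mathbb R^{n\times n}$ be symmetric positive definite. Assume that $(F,H)$ is observable. Let $\mathcal G$ be an undirected connected graph on the nodes $1,\dots,N$ with symmetric edge weights $a_{ij}=a_{ji}$, where $a_{ij}>0$ on edges and $a_{ij}=0$ otherwise. Let $\mathcal N_i$ be the set of neighbours of $i$, let $L=\operatorname{diag}\big(\sum_j a_{ij}\big)_i-(a_{ij})$ be the Laplacian, and let $\bar\sigma$ be an upper bound of the eigenvalues of $L$. Let the gains satisfy $0<\alpha_{\upsilon,i}<2/\bar\sigma^2$ for all $i$. **Algorithm (covariance part of DA-DKF).** Let $l^*\ge 1$ be the number of subiterations, let $P_{i,0}>0$ be arbitrary, and set $\omega_i=\operatorname{vech}(H_i^\top R_i^{-1}H_i)$ (half-vectorization), $\theta_{i,0,l^*}=\omega_i$, $\upsilon_{i,0,l^*}=0$. For $k=1,2,\dots$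 put $P_{i,k|k-1}=FP_{i,k-1}F^\top+Q$, $\theta_{i,k,0}=\theta_{i,k-1,l^*}$, $\upsilon_{i,k,0}=\upsilon_{i,k-1,l^*}$; for $l=0,\dots,l^*-1$ $$\upsilon_{i,k,l+1}=\upsilon_{i,k,l}+\alpha_{\upsilon,i}\sum_{j\in\mathcal N_i}a_{ij}(\theta_{i,k,l}-\theta_{j,k,l}),\qquad \theta_{i,k,l+1}=N\omega_i-\sum_{j\in\mathcal N_i}a_{ij}(\upsilon_{i,k,l+1}-\upsilon_{j,k,l+1});$$ and then $\Theta_{i,k,l^*}=\operatorname{vech}^{-1}(\theta_{i,k,l^*})$ and $P_{i,k}=(P_{i,k|k-1}^{-1}+\Theta_{i,k,l^*})^{-1}$. **Theorem.** The discrete algebraic Riccati equation of the centralized Kalman filter, $$P=F\{P-PH^\top(HPH^\top+\bar R)^{-1}HP\}F^\top+Q,$$ has a unique symmetric positive definite solution $P^*$, and the following hold. 1. For every $l^*\ge1$, all $P_{1,0},\dots,P_{N,0}>0$ and every node $i$: if the matrices $P_{i,k}$, $k\ge1$, generated by the algorithm are (well defined and) positive definite, then $\lim_{k\to\infty}P_{i,k|k-1}=P^*$.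 2. There is $\bar l^*\ge1$ such that for every $l^*\ge\bar l^*$, all $P_{1,0},\dots,P_{N,0}>0$ and every node $i$, the matrices $P_{i,k}$, $k\ge 1$, are positive definite and $\lim_{k\to\infty}P_{i,k|k-1}=P^*$. 3. Modify the algorithm by exception handling: whenever $\Theta_{i,k,l^*}$ is not positive semidefinite, some positive semidefinite matrix (for instance the projection of $\Theta_{i,k,l^*}$ onto the positive semidefinite matrices) is used in its place in the formula for $P_{i,k}$. Then for every $l^*\ge1$, all $P_{1,0},\dots,P_{N,0}>0$ and every node $i$, the matrices $P_{i,k}$, $k\ge1$, are positive definite and $\lim_{k\to\infty}P_{i,k|k-1}=P^*$. -/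

import Mathlib

open Filter Topology
open scoped Matrix

noncomputable section

namespace DADKF

/-! ### Plant, sensors, observability, Riccati equation -/

/-- The stacked output matrix `H = [H₁; …; H_N]`. -/
def stack {n N : ℕ} {m : Fin N → ℕ} (H : (i : Fin N) → Matrix (Fin (m i)) (Fin n) ℝ) :
    Matrix ((i : Fin N) × Fin (m i)) (Fin n) ℝ :=
  Matrix.of fun p b => H p.1 p.2 b

/-- The observability matrix `[C; C F; …; C F^(n-1)]` of a pair `(F, C)`. -/
def observabilityMatrix {n : ℕ} {p : Type*} (F : Matrix (Fin n) (Fin n) ℝ)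
    (C : Matrix p (Fin n) ℝ) : Matrix (Fin n × p) (Fin n) ℝ :=
  Matrix.of fun r b => (C * F ^ (r.1 : ℕ)) r.2 b

/-- The pair `(F, C)` is observable: its observability matrix has full column rank. -/
def Observable {n : ℕ} {p : Type*} (F : Matrix (Fin n) (Fin n) ℝ)
    (C : Matrix p (Fin n) ℝ) : Prop :=
  (observabilityMatrix F C).rank = n

/-- `P` solves the discrete-time algebraic Riccati equation of the Kalman filter with system matrix
`F`, output matrix `C`, process noise covariance `Q` and measurement noise covariance `R`. -/
def SolvesDARE {n : ℕ} {p : Type*} [Fintype p] [DecidableEq p]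
    (F Q : Matrix (Fin n) (Fin n) ℝ) (C : Matrix p (Fin n) ℝ) (R : Matrix p p ℝ)
    (P : Matrix (Fin n) (Fin n) ℝ) : Prop :=
  P = F * (P - P * Cᵀ * (C * P * Cᵀ + R)⁻¹ * C * P) * Fᵀ + Q

/-! ### Network -/

/-- The Laplacian `L = diag(∑ⱼ aᵢⱼ) - (aᵢⱼ)` of a weight matrix `a`. -/
def laplacian {N : ℕ} (a : Matrix (Fin N) (Fin N) ℝ) : Matrix (Fin N) (Fin N) ℝ :=
  Matrix.diagonal (fun i => ∑ j, a i j) - a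

/-! ### Half-vectorization -/

/-- Positions of the upper triangular part of an `n × n` matrix. -/
abbrev UpperIdx (n : ℕ) : Type := {p : Fin n × Fin n // p.1 ≤ p.2}

/-- The half-vectorization: the upper triangular entries of `M`. -/
def vech {n : ℕ} (M : Matrix (Fin n) (Fin n) ℝ) : UpperIdx n → ℝ :=
  fun p => M p.1.1 p.1.2

/-- The symmetric matrix with prescribed upper triangular part. -/
def invVech {n : ℕ} (v : UpperIdx n → ℝ) : Matrix (Fin n) (Fin n) ℝ :=
  Matrix.of fun b c => v ⟨(min b c, max b c), min_le_max⟩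

/-! ### The information-rate part of the algorithm -/

/-- The variables `(υᵢ)ᵢ` (dual) and `(θᵢ)ᵢ` (primal) held by the `N` estimators. -/
structure ConsensusState (n N : ℕ) where
  /-- dual variables -/
  dual : Fin N → UpperIdx n → ℝ
  /-- primal variables -/
  primal : Fin N → UpperIdx n → ℝ

/-- The local information rate `ωᵢ = vech (Hᵢᵀ Rᵢ⁻¹ Hᵢ)`. -/
def localRate {n N : ℕ} {m : Fin N → ℕ} (H : (i : Fin N) → Matrix (Fin (m i)) (Fin n) ℝ)
    (R : (i : Fin N) → Matrix (Fin (m i)) (Fin (m i)) ℝ) (i : Fin N) : UpperIdx n → ℝ :=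
  vech ((H i)ᵀ * (R i)⁻¹ * H i)

/-- The dual half of a subiteration:
`υᵢ⁺ = υᵢ + αᵢ ∑_{j ∈ 𝒩ᵢ} aᵢⱼ (θᵢ - θⱼ)`. -/
def dualStep {n N : ℕ} (G : SimpleGraph (Fin N)) [DecidableRel G.Adj]
    (a : Matrix (Fin N) (Fin N) ℝ) (α : Fin N → ℝ) (s : ConsensusState n N)
    (i : Fin N) : UpperIdx n → ℝ :=
  s.dual i + α i • ∑ j ∈ G.neighborFinset i, a i j • (s.primal i - s.primal j)

/-- One subiteration: the dual step, followed by the primal step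
`θᵢ⁺ = N ωᵢ - ∑_{j ∈ 𝒩ᵢ} aᵢⱼ (υᵢ⁺ - υⱼ⁺)`. -/
def subiteration {n N : ℕ} (G : SimpleGraph (Fin N)) [DecidableRel G.Adj]
    (a : Matrix (Fin N) (Fin N) ℝ) (α : Fin N → ℝ) (ω : Fin N → UpperIdx n → ℝ)
    (s : ConsensusState n N) : ConsensusState n N where
  dual := dualStep G a α s
  primal := fun i => (N : ℝ) • ω i -
    ∑ j ∈ G.neighborFinset i, a i j • (dualStep G a α s i - dualStep G a α s j)

/-- `(υ_{i,k,l*}, θ_{i,k,l*})ᵢ`: the state at the end of time step `k`. Each time step performs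
`lstar` subiterations, started from the final state of the previous time step; at `k = 0`,
`υᵢ = 0` and `θᵢ = ωᵢ`. -/
def consensusState {n N : ℕ} (G : SimpleGraph (Fin N)) [DecidableRel G.Adj]
    (a : Matrix (Fin N) (Fin N) ℝ) (α : Fin N → ℝ) (ω : Fin N → UpperIdx n → ℝ) (lstar : ℕ) :
    ℕ → ConsensusState n N
  | 0 => ⟨fun _ => 0, ω⟩
  | k + 1 => (subiteration G a α ω)^[lstar] (consensusState G a α ω lstar k)

/-- `Θ_{i,k,l*} = vech⁻¹ (θ_{i,k,l*})`. -/
def infoRate {n N : ℕ} {m : Fin N → ℕ} (H : (i : Fin N) → Matrix (Fin (m i)) (Fin n) ℝ)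
    (R : (i : Fin N) → Matrix (Fin (m i)) (Fin (m i)) ℝ)
    (G : SimpleGraph (Fin N)) [DecidableRel G.Adj]
    (a : Matrix (Fin N) (Fin N) ℝ) (α : Fin N → ℝ) (lstar : ℕ) (i : Fin N) (k : ℕ) :
    Matrix (Fin n) (Fin n) ℝ :=
  invVech ((consensusState G a α (localRate H R) lstar k).primal i)

/-! ### The covariance part of the algorithm -/

/-- Prediction `F P Fᵀ + Q`. -/
def predict {n : ℕ} (F Q P : Matrix (Fin n) (Fin n) ℝ) : Matrix (Fin n) (Fin n) ℝ :=
  F * P * Fᵀ + Q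

/-- The corrected covariances `P_k` of an estimator that starts from `P₀` and uses the matrix `Θ k`
in the correction at time `k`: `P_k = (P_{k|k-1}⁻¹ + Θ k)⁻¹` with `P_{k|k-1} = F P_{k-1} Fᵀ + Q`,
for `k ≥ 1`. -/
def corrCov {n : ℕ} (F Q : Matrix (Fin n) (Fin n) ℝ) (Θ : ℕ → Matrix (Fin n) (Fin n) ℝ)
    (P₀ : Matrix (Fin n) (Fin n) ℝ) : ℕ → Matrix (Fin n) (Fin n) ℝ
  | 0 => P₀
  | k + 1 => ((predict F Q (corrCov F Q Θ P₀ k))⁻¹ + Θ (k + 1))⁻¹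

/-- The predicted covariance `P_{k+1|k} = F P_k Fᵀ + Q`. -/
def predCov {n : ℕ} (F Q : Matrix (Fin n) (Fin n) ℝ) (Θ : ℕ → Matrix (Fin n) (Fin n) ℝ)
    (P₀ : Matrix (Fin n) (Fin n) ℝ) (k : ℕ) : Matrix (Fin n) (Fin n) ℝ :=
  predict F Q (corrCov F Q Θ P₀ k)

end DADKF

end

noncomputable section

namespace DADKF

open Matrix

/-! ### Spectral bound for positive semidefinite matrices -/

/-! The proof combines linear consensus of the information rates with a contraction property of the
Riccati recursion.

Consensus. With `D` the diagonal matrix of gains and `L` the Laplacian, eliminating the dual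
variables turns every subiteration after the first into `θ ↦ (1 - L D L) θ`. The gain bound makes
the Euclidean norm decrease by at least a positive multiple of each squared entry of `L θ`. Hence
the powers of `1 - L D L` tend to zero on zero-sum vectors, while constants are fixed. Each `Θ` is
therefore a combination of the matrices `Wⱼ = Hⱼᵀ Rⱼ⁻¹ Hⱼ` whose coefficients tend to 1
(`tendsto_consensusCoeff`, `infoRate_eq`). Since each `Wⱼ` is positive semidefinite, `Θ` is
eventually positive semidefinite and lies between `(1 + ε)⁻¹ S` and `(1 + ε) S`, where `S = ∑ Wⱼ`,
even if `S` is singular.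

Riccati. If `A ≤ (1 + t) B`, correction preserves the factor `1 + t`, and adding the same `Q` to
both sides strictly improves it, because `Q` dominates a multiple of the new `B`
(`quad_riccatiStep_le`). Such multiplicative comparisons absorb the vanishing error in `Θ`; used in
both directions they give convergence to any positive definite fixed point (`tendsto_riccati`),
hence also uniqueness. A fixed point exists because the recursion started at `Q` increases, and
observability bounds it (`exists_riccatiStep_fixedPoint`). -/

theorem mulVec_dotProduct_self_le_of_eigenvalue_le {ι : Type*} [Fintype ι] [DecidableEq ι]
    {A : Matrix ι ι ℝ} (hA : A.PosSemidef) {σ : ℝ}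
    (hσ : ∀ μ : ℝ, Module.End.HasEigenvalue (Matrix.toLin' A) μ → μ ≤ σ) (x : ι → ℝ) :
    (A *ᵥ x) ⬝ᵥ (A *ᵥ x) ≤ σ ^ 2 * (x ⬝ᵥ x) := by
  set b := hA.1.eigenvectorBasis
  have hnorm : ∀ y : ι → ℝ, y ⬝ᵥ y = ∑ i, (y ⬝ᵥ (b i).ofLp) ^ 2 := by
    intro y
    have h := b.sum_sq_norm_inner_right (WithLp.toLp 2 y)
    rw [EuclideanSpace.real_norm_sq_eq] at h
    simp only [EuclideanSpace.inner_eq_star_dotProduct, star_trivial, Real.norm_eq_abs,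
      sq_abs] at h
    rw [h]
    simp [dotProduct, sq]
  have heig : ∀ i, A *ᵥ (b i).ofLp = hA.1.eigenvalues i • (b i).ofLp := fun i =>
    hA.1.mulVec_eigenvectorBasis i
  have hinner : ∀ i, (A *ᵥ x) ⬝ᵥ (b i).ofLp = hA.1.eigenvalues i * (x ⬝ᵥ (b i).ofLp) := by
    intro i
    have hT : Aᵀ = A := hA.1
    rw [dotProduct_comm, dotProduct_mulVec, ← mulVec_transpose, hT, heig, smul_dotProduct,
      smul_eq_mul, dotProduct_comm]
  have hle : ∀ i, hA.1.eigenvalues i ≤ σ := by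
    intro i
    apply hσ
    apply Module.End.hasEigenvalue_of_hasEigenvector (x := (b i).ofLp)
    refine ⟨Module.End.mem_eigenspace_iff.2 (by rw [Matrix.toLin'_apply, heig]), fun h => ?_⟩
    apply b.orthonormal.ne_zero i
    ext j
    exact congrFun h j
  rw [hnorm, hnorm x, Finset.mul_sum]
  refine Finset.sum_le_sum fun i _ => ?_
  rw [hinner, mul_pow]
  -- Semidefiniteness is needed here: `λ ≤ σ` survives squaring only because `0 ≤ λ`.
  gcongr
  · exact hA.eigenvalues_nonneg i
  · exact hle i

/-! ### The Laplacian -/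

variable {n N : ℕ}

theorem laplacian_mulVec (a : Matrix (Fin N) (Fin N) ℝ) (x : Fin N → ℝ) (i : Fin N) :
    (laplacian a *ᵥ x) i = ∑ j, a i j * (x i - x j) := by
  rw [laplacian, sub_mulVec, Pi.sub_apply, mulVec_diagonal, Finset.sum_mul, mulVec, dotProduct,
    ← Finset.sum_sub_distrib]
  exact Finset.sum_congr rfl fun j _ => by ring

theorem laplacian_transpose {a : Matrix (Fin N) (Fin N) ℝ} (ha : a.IsSymm) :
    (laplacian a)ᵀ = laplacian a := by
  rw [laplacian, transpose_sub, diagonal_transpose, ha]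

theorem dotProduct_laplacian_mulVec {a : Matrix (Fin N) (Fin N) ℝ} (ha : a.IsSymm)
    (x : Fin N → ℝ) :
    x ⬝ᵥ laplacian a *ᵥ x = (1 / 2) * ∑ i, ∑ j, a i j * (x i - x j) ^ 2 := by
  have h1 : x ⬝ᵥ laplacian a *ᵥ x = ∑ i, ∑ j, a i j * (x i * (x i - x j)) := by
    simp only [dotProduct, laplacian_mulVec, Finset.mul_sum]
    exact Finset.sum_congr rfl fun i _ => Finset.sum_congr rfl fun j _ => by ring
  have h2 : x ⬝ᵥ laplacian a *ᵥ x = ∑ i, ∑ j, a i j * (x j * (x j - x i)) := by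
    rw [h1, Finset.sum_comm]
    exact Finset.sum_congr rfl fun i _ => Finset.sum_congr rfl fun j _ => by rw [ha.apply]
  have h3 : ∑ i, ∑ j, a i j * (x i - x j) ^ 2 =
      ∑ i, ∑ j, a i j * (x i * (x i - x j)) + ∑ i, ∑ j, a i j * (x j * (x j - x i)) := by
    rw [← Finset.sum_add_distrib]
    refine Finset.sum_congr rfl fun i _ => ?_
    rw [← Finset.sum_add_distrib]
    exact Finset.sum_congr rfl fun j _ => by ring
  rw [h3, ← h1, ← h2]
  ring

/-- The hypotheses on a weighted undirected connected network with graph `G`, weights `a`. -/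
structure IsNetwork (G : SimpleGraph (Fin N)) (a : Matrix (Fin N) (Fin N) ℝ) : Prop where
  symm : a.IsSymm
  pos : ∀ i j, G.Adj i j → 0 < a i j
  zero : ∀ i j, ¬ G.Adj i j → a i j = 0
  connected : G.Connected

namespace IsNetwork

variable {G : SimpleGraph (Fin N)} {a : Matrix (Fin N) (Fin N) ℝ}

theorem nonneg (h : IsNetwork G a) (i j : Fin N) : 0 ≤ a i j := by
  by_cases hij : G.Adj i j
  · exact (h.pos i j hij).le
  · rw [h.zero i j hij]

theorem laplacian_posSemidef (h : IsNetwork G a) : (laplacian a).PosSemidef := by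
  refine PosSemidef.of_dotProduct_mulVec_nonneg ?_ fun x => ?_
  · rw [IsHermitian, conjTranspose_eq_transpose_of_trivial, laplacian_transpose h.symm]
  · rw [star_trivial, dotProduct_laplacian_mulVec h.symm]
    exact mul_nonneg (by norm_num) (Finset.sum_nonneg fun i _ => Finset.sum_nonneg fun j _ =>
      mul_nonneg (h.nonneg i j) (sq_nonneg _))

/-- Zero Dirichlet energy forces equality across every edge; walks propagate it. -/
theorem eq_of_laplacian_mulVec_eq_zero (h : IsNetwork G a) {x : Fin N → ℝ}
    (hx : x ⬝ᵥ laplacian a *ᵥ x = 0) (i j : Fin N) : x i = x j := by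
  rw [dotProduct_laplacian_mulVec h.symm] at hx
  have hnn : ∀ i j, 0 ≤ a i j * (x i - x j) ^ 2 := fun i j =>
    mul_nonneg (h.nonneg i j) (sq_nonneg _)
  have hadj : ∀ i j, G.Adj i j → x i = x j := by
    intro i j hij
    have h0 : ∑ i, ∑ j, a i j * (x i - x j) ^ 2 = 0 := by linarith
    have h1 := (Finset.sum_eq_zero_iff_of_nonneg
      fun i _ => Finset.sum_nonneg fun j _ => hnn i j).1 h0 i (Finset.mem_univ _)
    have h2 := (Finset.sum_eq_zero_iff_of_nonneg fun j _ => hnn i j).1 h1 j (Finset.mem_univ _)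
    have h3 := (mul_eq_zero.1 h2).resolve_left (h.pos i j hij).ne'
    exact sub_eq_zero.1 (pow_eq_zero_iff two_ne_zero |>.1 h3)
  obtain ⟨w⟩ := h.connected.preconnected i j
  induction w with
  | nil => rfl
  | cons hij _ ih => exact (hadj _ _ hij).trans ih

/-- Vectors with zero sum are recovered continuously from their image under the Laplacian. -/
theorem exists_leftInverse_laplacian (h : IsNetwork G a) :
    ∃ B : Matrix (Fin N) (Fin N) ℝ, ∀ x : Fin N → ℝ, ∑ i, x i = 0 →
      B *ᵥ (laplacian a *ᵥ x) = x := by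
  -- The all-ones matrix repairs the kernel of `L` (the constants) and kills zero-sum vectors, so
  -- `(L + J)⁻¹` undoes `L` on them.
  set J : Matrix (Fin N) (Fin N) ℝ := Matrix.of fun _ _ => 1
  have hJ : ∀ (x : Fin N → ℝ), J *ᵥ x = fun _ => ∑ i, x i := by
    intro x
    ext i
    simp [J, mulVec, dotProduct]
  have hpd : (laplacian a + J).PosDef := by
    refine PosDef.of_dotProduct_mulVec_pos ?_ fun x hx => ?_
    · refine h.laplacian_posSemidef.1.add ?_
      ext i j
      simp [J]
    · have h1 := h.laplacian_posSemidef.dotProduct_mulVec_nonneg x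
      rw [star_trivial] at h1 ⊢
      have h2 : x ⬝ᵥ J *ᵥ x = (∑ i, x i) ^ 2 := by
        rw [hJ, dotProduct, ← Finset.sum_mul, sq]
      rw [add_mulVec, dotProduct_add, h2]
      refine lt_of_le_of_ne (add_nonneg h1 (sq_nonneg _)) fun h0 => hx ?_
      have h3 : x ⬝ᵥ laplacian a *ᵥ x = 0 := by nlinarith [sq_nonneg (∑ i, x i)]
      have h4 : ∑ i, x i = 0 := by
        have : (∑ i, x i) ^ 2 = 0 := by linarith
        exact pow_eq_zero_iff two_ne_zero |>.1 this
      ext i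
      have h5 : ∑ j, x j = N * x i := by
        rw [Finset.sum_congr rfl fun j _ => h.eq_of_laplacian_mulVec_eq_zero h3 j i]
        simp
      have hN : (N : ℝ) ≠ 0 := by
        have := i.pos
        positivity
      rw [h4] at h5
      simpa [hN] using h5.symm
  refine ⟨(laplacian a + J)⁻¹, fun x hx => ?_⟩
  have h1 : laplacian a *ᵥ x = (laplacian a + J) *ᵥ x := by
    rw [add_mulVec, hJ, hx]
    simp [← Pi.zero_def]
  rw [h1, mulVec_mulVec, nonsing_inv_mul _ ((isUnit_iff_isUnit_det _).1 hpd.isUnit), one_mulVec]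

theorem sum_laplacian_mulVec (h : IsNetwork G a) (x : Fin N → ℝ) :
    ∑ i, (laplacian a *ᵥ x) i = 0 := by
  have h1 : ∑ i, (laplacian a *ᵥ x) i = (laplacian a *ᵥ x) ⬝ᵥ 1 := by simp [dotProduct]
  rw [h1, dotProduct_comm, dotProduct_mulVec, ← mulVec_transpose, laplacian_transpose h.symm]
  have h2 : laplacian a *ᵥ 1 = 0 := by
    ext i
    simp [laplacian_mulVec]
  rw [h2, zero_dotProduct]

end IsNetwork

/-! ### The primal-dual consensus iteration -/

/-- The matrix `1 - L D L` that propagates the primal variables, `D` being the diagonal matrix of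
the gains. -/
def consensusMatrix (a : Matrix (Fin N) (Fin N) ℝ) (α : Fin N → ℝ) : Matrix (Fin N) (Fin N) ℝ :=
  1 - laplacian a * Matrix.diagonal α * laplacian a

theorem consensusMatrix_mulVec (a : Matrix (Fin N) (Fin N) ℝ) (α x : Fin N → ℝ) :
    consensusMatrix a α *ᵥ x = x - laplacian a *ᵥ (α * laplacian a *ᵥ x) := by
  rw [consensusMatrix, sub_mulVec, one_mulVec, ← mulVec_mulVec, ← mulVec_mulVec]
  congr 2
  ext i
  rw [mulVec_diagonal, Pi.mul_apply]

/-- The coefficients of the primal variables with respect to the local rates. -/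
def consensusCoeff (a : Matrix (Fin N) (Fin N) ℝ) (α : Fin N → ℝ) (l : ℕ) :
    Matrix (Fin N) (Fin N) ℝ :=
  consensusMatrix a α ^ l *
    ((N : ℝ) • (1 : Matrix (Fin N) (Fin N) ℝ) - laplacian a * Matrix.diagonal α * laplacian a)

variable {G : SimpleGraph (Fin N)} {a : Matrix (Fin N) (Fin N) ℝ}

/-- Expand `|x - L D z|²` with `z = L x`: the cross term is `-2 ∑ αᵢ zᵢ²`, and the spectral bound
controls `|L D z|²` by `σbar² ∑ αᵢ² zᵢ²`. -/
theorem IsNetwork.consensusMatrix_dotProduct_le (h : IsNetwork G a) {α : Fin N → ℝ} {σbar : ℝ}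
    (hσ : ∀ μ : ℝ, Module.End.HasEigenvalue (Matrix.toLin' (laplacian a)) μ → μ ≤ σbar)
    (x : Fin N → ℝ) :
    (consensusMatrix a α *ᵥ x) ⬝ᵥ (consensusMatrix a α *ᵥ x) ≤
      x ⬝ᵥ x - ∑ i, α i * (2 - σbar ^ 2 * α i) * (laplacian a *ᵥ x) i ^ 2 := by
  set z := laplacian a *ᵥ x
  have h1 := mulVec_dotProduct_self_le_of_eigenvalue_le h.laplacian_posSemidef hσ (α * z)
  have h2 : x ⬝ᵥ laplacian a *ᵥ (α * z) = ∑ i, α i * z i ^ 2 := by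
    rw [dotProduct_mulVec, ← mulVec_transpose, laplacian_transpose h.symm]
    exact Finset.sum_congr rfl fun i _ => by simp only [Pi.mul_apply]; ring
  have h3 : σbar ^ 2 * ((α * z) ⬝ᵥ (α * z)) = ∑ i, σbar ^ 2 * (α i * z i) ^ 2 := by
    rw [dotProduct, Finset.mul_sum]
    exact Finset.sum_congr rfl fun i _ => by simp only [Pi.mul_apply]; ring
  have h4 : ∑ i, α i * (2 - σbar ^ 2 * α i) * z i ^ 2 =
      2 * (∑ i, α i * z i ^ 2) - ∑ i, σbar ^ 2 * (α i * z i) ^ 2 := by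
    rw [Finset.mul_sum, ← Finset.sum_sub_distrib]
    exact Finset.sum_congr rfl fun i _ => by ring
  rw [consensusMatrix_mulVec, sub_dotProduct, dotProduct_sub, dotProduct_sub,
    dotProduct_comm (laplacian a *ᵥ (α * z)) x, h2, h4, ← h3]
  linarith

/-- The iteration matrix is asymptotically stable on the vectors with zero sum. -/
theorem IsNetwork.tendsto_consensusMatrix_pow (h : IsNetwork G a) {α : Fin N → ℝ} {σbar : ℝ}
    (hα : ∀ i, 0 < α i ∧ α i < 2 / σbar ^ 2)
    (hσ : ∀ μ : ℝ, Module.End.HasEigenvalue (Matrix.toLin' (laplacian a)) μ → μ ≤ σbar)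
    {x : Fin N → ℝ} (hx : ∑ i, x i = 0) :
    Tendsto (fun l => consensusMatrix a α ^ l *ᵥ x) atTop (𝓝 0) := by
  set e : ℕ → Fin N → ℝ := fun l => consensusMatrix a α ^ l *ᵥ x
  have he : ∀ l, e (l + 1) = consensusMatrix a α *ᵥ e l := by
    intro l
    simp only [e, pow_succ', mulVec_mulVec]
  have hsum : ∀ l, ∑ i, e l i = 0 := by
    intro l
    induction l with
    | zero => simpa [e] using hx
    | succ l ih =>
      rw [he, consensusMatrix_mulVec]
      simp only [Pi.sub_apply, Finset.sum_sub_distrib, ih, h.sum_laplacian_mulVec, sub_zero]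
  have hcoef : ∀ i, 0 < α i * (2 - σbar ^ 2 * α i) := by
    intro i
    -- For `σbar = 0`, the convention `2 / 0 = 0` would contradict `0 < α i < 2 / σbar ^ 2`.
    have hs : 0 < σbar ^ 2 := by
      rcases (sq_nonneg σbar).eq_or_lt with h0 | h0
      · have := hα i
        rw [← h0, div_zero] at this
        linarith
      · exact h0
    have := (lt_div_iff₀ hs).1 (hα i).2
    exact mul_pos (hα i).1 (by linarith)
  have hdec := fun l => h.consensusMatrix_dotProduct_le (α := α) hσ (e l)
  simp only [← he] at hdec
  set V : ℕ → ℝ := fun l => e l ⬝ᵥ e l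
  have hV0 : ∀ l, 0 ≤ V l := fun l => Finset.sum_nonneg fun i _ => mul_self_nonneg _
  have hterm : ∀ l i, α i * (2 - σbar ^ 2 * α i) * (laplacian a *ᵥ e l) i ^ 2 ≤
      V l - V (l + 1) := by
    intro l i
    have h1 := Finset.single_le_sum
      (f := fun i => α i * (2 - σbar ^ 2 * α i) * (laplacian a *ᵥ e l) i ^ 2)
      (fun i _ => mul_nonneg (hcoef i).le (sq_nonneg _)) (Finset.mem_univ i)
    have h2 : V (l + 1) ≤ V l - _ := hdec l
    linarith
  have hanti : Antitone V := by
    refine antitone_nat_of_succ_le fun l => ?_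
    have h1 : V (l + 1) ≤ V l - _ := hdec l
    have h2 : 0 ≤ ∑ i, α i * (2 - σbar ^ 2 * α i) * (laplacian a *ᵥ e l) i ^ 2 :=
      Finset.sum_nonneg fun i _ => mul_nonneg (hcoef i).le (sq_nonneg _)
    linarith
  have hlim := tendsto_atTop_ciInf hanti ⟨0, by rintro _ ⟨l, rfl⟩; exact hV0 l⟩
  have hdiff : Tendsto (fun l => V l - V (l + 1)) atTop (𝓝 0) := by
    simpa using hlim.sub (hlim.comp (tendsto_add_atTop_nat 1))
  -- The energy `V` converges, so its decrements vanish, and they dominate the squared entries of `L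
  -- e`.
  have hL : Tendsto (fun l => laplacian a *ᵥ e l) atTop (𝓝 0) := by
    refine tendsto_pi_nhds.2 fun i => ?_
    have h1 : Tendsto (fun l => (laplacian a *ᵥ e l) i ^ 2) atTop (𝓝 0) := by
      refine squeeze_zero (fun l => sq_nonneg _) (fun l => ?_)
        (by simpa using hdiff.div_const (α i * (2 - σbar ^ 2 * α i)))
      rw [le_div_iff₀ (hcoef i), mul_comm]
      exact hterm l i
    have h2 := h1.sqrt
    simp only [Real.sqrt_sq_eq_abs, Real.sqrt_zero] at h2
    exact (tendsto_zero_iff_abs_tendsto_zero _).2 h2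
  obtain ⟨B, hB⟩ := h.exists_leftInverse_laplacian
  have h1 : Tendsto (fun l => B *ᵥ (laplacian a *ᵥ e l)) atTop (𝓝 (B *ᵥ 0)) :=
    ((Continuous.matrix_mulVec continuous_const continuous_id).tendsto _).comp hL
  rw [mulVec_zero] at h1
  exact h1.congr fun l => hB _ (hsum l)

theorem IsNetwork.tendsto_consensusCoeff (h : IsNetwork G a) {α : Fin N → ℝ} {σbar : ℝ}
    (hα : ∀ i, 0 < α i ∧ α i < 2 / σbar ^ 2)
    (hσ : ∀ μ : ℝ, Module.End.HasEigenvalue (Matrix.toLin' (laplacian a)) μ → μ ≤ σbar)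
    (i j : Fin N) : Tendsto (fun l => consensusCoeff a α l i j) atTop (𝓝 1) := by
  have hone : ∀ l, consensusMatrix a α ^ l *ᵥ 1 = 1 := by
    have hL : laplacian a *ᵥ 1 = 0 := by
      ext i
      simp [laplacian_mulVec]
    intro l
    induction l with
    | zero => simp
    | succ l ih => rw [pow_succ', ← mulVec_mulVec, ih, consensusMatrix_mulVec, hL]; simp
  -- This is column `j` of the coefficients at `l = 0`. Its sum is `N`, so it differs from the fixed
  -- vector `1` by a zero-sum vector.
  set y : Fin N → ℝ := ((N : ℝ) • (1 : Matrix (Fin N) (Fin N) ℝ) -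
    laplacian a * Matrix.diagonal α * laplacian a) *ᵥ Pi.single j 1
  have hy : ∑ i, (y - 1) i = 0 := by
    simp only [y, sub_mulVec, smul_mulVec, one_mulVec, ← mulVec_mulVec, Pi.sub_apply,
      Finset.sum_sub_distrib, h.sum_laplacian_mulVec, Pi.smul_apply, smul_eq_mul,
      ← Finset.mul_sum]
    simp
  have h1 := tendsto_pi_nhds.1 (h.tendsto_consensusMatrix_pow hα hσ hy) i
  have h2 : ∀ l, consensusCoeff a α l i j = (consensusMatrix a α ^ l *ᵥ (y - 1)) i + 1 := by
    intro l
    rw [mulVec_sub, hone, Pi.sub_apply, Pi.one_apply, sub_add_cancel, mulVec_mulVec]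
    simp [consensusCoeff]
  simpa only [h2, Pi.zero_apply, zero_add] using h1.add_const 1

variable [DecidableRel G.Adj]

theorem IsNetwork.sum_neighborFinset (h : IsNetwork G a) (v : Fin N → UpperIdx n → ℝ)
    (i : Fin N) (p : UpperIdx n) :
    (∑ j ∈ G.neighborFinset i, a i j • (v i - v j)) p = (laplacian a *ᵥ fun j => v j p) i := by
  rw [laplacian_mulVec, Finset.sum_apply]
  refine Finset.sum_subset (Finset.subset_univ _) fun j _ hj => ?_
  rw [SimpleGraph.mem_neighborFinset] at hj
  simp [h.zero i j hj]

theorem consensusState_eq_iterate (α : Fin N → ℝ) (ω : Fin N → UpperIdx n → ℝ) (lstar k : ℕ) :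
    consensusState G a α ω lstar k =
      (subiteration G a α ω)^[k * lstar] ⟨fun _ => 0, ω⟩ := by
  induction k with
  | zero => simp [consensusState]
  | succ k ih =>
    change (subiteration G a α ω)^[lstar] (consensusState G a α ω lstar k) = _
    rw [ih, ← Function.iterate_add_apply, Nat.succ_mul, add_comm]

theorem IsNetwork.subiteration_dual (h : IsNetwork G a) (α : Fin N → ℝ)
    (ω : Fin N → UpperIdx n → ℝ) (s : ConsensusState n N) (p : UpperIdx n) :
    (fun i => (subiteration G a α ω s).dual i p) =
      (fun i => s.dual i p) + α * laplacian a *ᵥ fun i => s.primal i p := by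
  ext i
  simp only [subiteration, dualStep, Pi.add_apply, Pi.smul_apply, Pi.mul_apply, smul_eq_mul,
    h.sum_neighborFinset]

theorem IsNetwork.subiteration_primal (h : IsNetwork G a) (α : Fin N → ℝ)
    (ω : Fin N → UpperIdx n → ℝ) (s : ConsensusState n N) (p : UpperIdx n) :
    (fun i => (subiteration G a α ω s).primal i p) =
      (N : ℝ) • (fun i => ω i p) - laplacian a *ᵥ fun i => (subiteration G a α ω s).dual i p := by
  ext i
  simp only [subiteration, Pi.sub_apply, Pi.smul_apply, smul_eq_mul, h.sum_neighborFinset]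

/-- The relation `θ = N ω - L υ` holds after each subiteration but not necessarily at the initial
state `θ = ω`, `υ = 0`. Hence the offset `l + 1` and the separate first factor `N - L D L`. -/
theorem IsNetwork.iterate_subiteration_primal (h : IsNetwork G a) (α : Fin N → ℝ)
    (ω : Fin N → UpperIdx n → ℝ) (l : ℕ) (p : UpperIdx n) :
    (fun i => ((subiteration G a α ω)^[l + 1] ⟨fun _ => 0, ω⟩).primal i p) =
      consensusCoeff a α l *ᵥ fun i => ω i p := by
  induction l with
  | zero =>
    rw [Function.iterate_succ_apply', h.subiteration_primal, h.subiteration_dual]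
    simp only [Function.iterate_zero_apply, consensusCoeff, pow_zero, one_mul, Pi.zero_apply,
      sub_mulVec, smul_mulVec, one_mulVec, ← mulVec_mulVec]
    congr 2
    ext i
    simp [mulVec_diagonal]
  | succ l ih =>
    have h1 : consensusCoeff a α (l + 1) = consensusMatrix a α * consensusCoeff a α l := by
      rw [consensusCoeff, consensusCoeff, pow_succ', Matrix.mul_assoc]
    rw [h1, ← mulVec_mulVec, ← ih, consensusMatrix_mulVec, Function.iterate_succ_apply',
      h.subiteration_primal, h.subiteration_dual, mulVec_add, ← sub_sub]
    congr 1
    rw [Function.iterate_succ_apply', ← h.subiteration_primal]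

/-! ### Quadratic forms of real matrices -/

section Quad

variable {ι κ : Type*} [Fintype ι] [Fintype κ]

/-- The quadratic form of a matrix. -/
def quad (A : Matrix ι ι ℝ) (x : ι → ℝ) : ℝ := x ⬝ᵥ A *ᵥ x

theorem quad_add (A B : Matrix ι ι ℝ) (x : ι → ℝ) : quad (A + B) x = quad A x + quad B x := by
  rw [quad, add_mulVec, dotProduct_add, quad, quad]

theorem quad_smul (c : ℝ) (A : Matrix ι ι ℝ) (x : ι → ℝ) : quad (c • A) x = c * quad A x := by
  rw [quad, smul_mulVec, dotProduct_smul, quad, smul_eq_mul]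

theorem quad_sum {β : Type*} (s : Finset β) (A : β → Matrix ι ι ℝ) (x : ι → ℝ) :
    quad (∑ j ∈ s, A j) x = ∑ j ∈ s, quad (A j) x := by
  rw [quad, sum_mulVec, dotProduct_sum]
  rfl

theorem quad_conj (A : Matrix ι ι ℝ) (B : Matrix κ ι ℝ) (x : κ → ℝ) :
    quad (B * A * Bᵀ) x = quad A (Bᵀ *ᵥ x) := by
  rw [quad, quad, ← mulVec_mulVec, ← mulVec_mulVec, dotProduct_mulVec, ← mulVec_transpose]

theorem _root_.Matrix.PosSemidef.quad_nonneg {A : Matrix ι ι ℝ} (hA : A.PosSemidef)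
    (x : ι → ℝ) : 0 ≤ quad A x := by
  simpa [quad] using hA.dotProduct_mulVec_nonneg x

theorem _root_.Matrix.PosDef.quad_pos {A : Matrix ι ι ℝ} (hA : A.PosDef) {x : ι → ℝ}
    (hx : x ≠ 0) : 0 < quad A x := by
  simpa [quad] using hA.dotProduct_mulVec_pos hx

theorem continuous_quad (A : Matrix ι ι ℝ) : Continuous (quad A) :=
  continuous_id.dotProduct (continuous_const.matrix_mulVec continuous_id)

theorem quad_smul_vec (A : Matrix ι ι ℝ) (c : ℝ) (x : ι → ℝ) :
    quad A (c • x) = c ^ 2 * quad A x := by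
  simp only [quad, mulVec_smul, dotProduct_smul, smul_dotProduct, smul_eq_mul]
  ring

theorem dotProduct_mulVec_comm {A : Matrix ι ι ℝ} (hA : A.IsHermitian) (x y : ι → ℝ) :
    x ⬝ᵥ A *ᵥ y = y ⬝ᵥ A *ᵥ x := by
  have hT : Aᵀ = A := hA
  rw [dotProduct_mulVec, ← mulVec_transpose, hT, dotProduct_comm]

theorem quad_add_vec {A : Matrix ι ι ℝ} (hA : A.IsHermitian) (x y : ι → ℝ) :
    quad A (x + y) = quad A x + 2 * (x ⬝ᵥ A *ᵥ y) + quad A y := by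
  simp only [quad, mulVec_add, dotProduct_add, add_dotProduct, dotProduct_mulVec_comm hA y x]
  ring

/-- A positive definite form dominates a multiple of any other form. -/
theorem _root_.Matrix.PosDef.exists_mul_quad_le {A : Matrix ι ι ℝ} (hA : A.PosDef)
    (B : Matrix ι ι ℝ) : ∃ c : ℝ, 0 < c ∧ ∀ x, quad B x ≤ c * quad A x := by
  have hcomp : IsCompact {x : ι → ℝ | ‖x‖ = 1} := by
    have h := isCompact_sphere (0 : ι → ℝ) 1
    have h' : Metric.sphere (0 : ι → ℝ) 1 = {x : ι → ℝ | ‖x‖ = 1} := by ext; simp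
    rwa [h'] at h
  have hcont : ContinuousOn (fun x => quad B x / quad A x) {x : ι → ℝ | ‖x‖ = 1} := by
    refine (continuous_quad B).continuousOn.div (continuous_quad A).continuousOn fun x hx => ?_
    refine (hA.quad_pos ?_).ne'
    rintro rfl
    simp at hx
  obtain ⟨c, hc⟩ := hcomp.bddAbove_image hcont
  -- The bound `c` on the unit sphere need not be positive.
  refine ⟨max c 1, by positivity, fun x => ?_⟩
  rcases eq_or_ne x 0 with rfl | hx
  · simp [quad]
  · have hn : 0 < ‖x‖ := norm_pos_iff.2 hx
    have hx1 : ‖‖x‖⁻¹ • x‖ = 1 := by rw [norm_smul, norm_inv, norm_norm, inv_mul_cancel₀ hn.ne']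
    have h1 : quad B (‖x‖⁻¹ • x) / quad A (‖x‖⁻¹ • x) ≤ c := hc ⟨_, hx1, rfl⟩
    rw [quad_smul_vec, quad_smul_vec, mul_div_mul_left _ _ (by positivity),
      div_le_iff₀ (hA.quad_pos hx)] at h1
    exact h1.trans (mul_le_mul_of_nonneg_right (le_max_left _ _) (hA.quad_pos hx).le)

variable [DecidableEq ι]

theorem _root_.Matrix.PosDef.mulVec_inv_mulVec {A : Matrix ι ι ℝ} (hA : A.PosDef) (x : ι → ℝ) :
    A *ᵥ (A⁻¹ *ᵥ x) = x := by
  rw [mulVec_mulVec, mul_nonsing_inv _ ((isUnit_iff_isUnit_det _).1 hA.isUnit), one_mulVec]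

theorem _root_.Matrix.PosDef.inv_inv {A : Matrix ι ι ℝ} (hA : A.PosDef) : A⁻¹⁻¹ = A :=
  nonsing_inv_nonsing_inv _ ((isUnit_iff_isUnit_det _).1 hA.isUnit)

/-- The Fenchel inequality for a positive definite form. -/
theorem _root_.Matrix.PosDef.two_mul_dotProduct_le {A : Matrix ι ι ℝ} (hA : A.PosDef)
    (w x : ι → ℝ) : 2 * (w ⬝ᵥ x) ≤ quad A x + quad A⁻¹ w := by
  -- Complete the square around `A⁻¹ w`.
  have h := hA.posSemidef.quad_nonneg (x + (-1 : ℝ) • A⁻¹ *ᵥ w)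
  rw [quad_add_vec hA.1, quad_smul_vec, mulVec_smul, hA.mulVec_inv_mulVec, dotProduct_smul,
    quad, quad, hA.mulVec_inv_mulVec, smul_eq_mul] at h
  rw [quad, quad, dotProduct_comm w x, dotProduct_comm w (A⁻¹ *ᵥ w)]
  linarith

/-- Inversion reverses the order of positive definite forms. -/
theorem quad_inv_le {A B : Matrix ι ι ℝ} (hA : A.PosDef) (hB : B.PosDef) {τ : ℝ} (hτ : 0 < τ)
    (h : ∀ x, quad A x ≤ τ * quad B x) (x : ι → ℝ) : quad B⁻¹ x ≤ τ * quad A⁻¹ x := by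
  -- The test vector `τ⁻¹ B⁻¹ x` maximizes `2 (w ⬝ᵥ x) - τ * quad B w`.
  have h1 := hA.inv.two_mul_dotProduct_le (τ⁻¹ • B⁻¹ *ᵥ x) x
  rw [hA.inv_inv, quad_smul_vec, smul_dotProduct, smul_eq_mul] at h1
  have h2 := h (B⁻¹ *ᵥ x)
  have h3 : quad B (B⁻¹ *ᵥ x) = quad B⁻¹ x := by
    rw [quad, hB.mulVec_inv_mulVec, quad, dotProduct_comm]
  rw [dotProduct_comm, ← quad] at h1
  rw [h3] at h2
  have h4 : (τ⁻¹) ^ 2 * quad A (B⁻¹ *ᵥ x) ≤ τ⁻¹ * quad B⁻¹ x := by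
    calc (τ⁻¹) ^ 2 * quad A (B⁻¹ *ᵥ x) ≤ (τ⁻¹) ^ 2 * (τ * quad B⁻¹ x) := by gcongr
      _ = τ⁻¹ * quad B⁻¹ x := by field_simp
  have h5 : τ⁻¹ * quad B⁻¹ x ≤ quad A⁻¹ x := by linarith
  rwa [inv_mul_le_iff₀ hτ] at h5

/-- Comparison of corrected covariances. -/
theorem quad_corrected_le {A B Θ Ξ : Matrix ι ι ℝ} (hA : A.PosDef) (hB : B.PosDef)
    (hΘ : Θ.PosSemidef) (hΞ : Ξ.PosSemidef) {τ : ℝ} (hτ : 0 < τ)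
    (h : ∀ x, quad A x ≤ τ * quad B x) (h' : ∀ x, quad Ξ x ≤ τ * quad Θ x) (x : ι → ℝ) :
    quad (A⁻¹ + Θ)⁻¹ x ≤ τ * quad (B⁻¹ + Ξ)⁻¹ x := by
  refine quad_inv_le (hB.inv.add_posSemidef hΞ) (hA.inv.add_posSemidef hΘ) hτ (fun y => ?_) x
  rw [quad_add, quad_add, mul_add]
  exact add_le_add (quad_inv_le hA hB hτ h y) (h' y)

/-- Polarization reduces entrywise limits to limits of quadratic forms. -/
theorem matrix_entry_eq_quad {A : Matrix ι ι ℝ} (hA : A.IsHermitian) (i j : ι) :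
    A i j = (quad A (Pi.single i 1 + Pi.single j 1) - quad A (Pi.single i 1) -
      quad A (Pi.single j 1)) / 2 := by
  rw [quad_add_vec hA]
  simp only [single_one_dotProduct, mulVec_single_one, col_apply]
  ring

/-- Convergence of symmetric matrices can be tested on their quadratic forms. -/
theorem tendsto_of_tendsto_quad {A : ℕ → Matrix ι ι ℝ} {B : Matrix ι ι ℝ}
    (hA : ∀ᶠ k in atTop, (A k).IsHermitian) (hB : B.IsHermitian)
    (h : ∀ x, Tendsto (fun k => quad (A k) x) atTop (𝓝 (quad B x))) :
    Tendsto A atTop (𝓝 B) := by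
  refine tendsto_pi_nhds.2 fun i => tendsto_pi_nhds.2 fun j => ?_
  rw [matrix_entry_eq_quad hB]
  refine ((((h _).sub (h _)).sub (h _)).div_const 2).congr' ?_
  filter_upwards [hA] with k hk
  rw [matrix_entry_eq_quad hk]

theorem tendsto_matrix_inv {A : ℕ → Matrix ι ι ℝ} {B : Matrix ι ι ℝ}
    (h : Tendsto A atTop (𝓝 B)) (hB : IsUnit B) : Tendsto (fun k => (A k)⁻¹) atTop (𝓝 B⁻¹) := by
  have hdet : B.det ≠ 0 := ((isUnit_iff_isUnit_det _).1 hB).ne_zero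
  simp only [inv_def, Ring.inverse_eq_inv']
  exact (((continuous_id.matrix_det.tendsto B).comp h).inv₀ hdet).smul
    ((continuous_id.matrix_adjugate.tendsto B).comp h)

/-- A pointwise bounded monotone sequence of symmetric matrices converges. -/
theorem exists_tendsto_of_quad_monotone {A : ℕ → Matrix ι ι ℝ} (hA : ∀ k, (A k).IsHermitian)
    (hmono : ∀ x, Monotone fun k => quad (A k) x)
    (hbdd : ∀ x, ∃ b, ∀ᶠ k in atTop, quad (A k) x ≤ b) :
    ∃ B : Matrix ι ι ℝ, B.IsHermitian ∧ Tendsto A atTop (𝓝 B) := by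
  have hlim : ∀ x, ∃ l, Tendsto (fun k => quad (A k) x) atTop (𝓝 l) := by
    intro x
    obtain ⟨b, hb⟩ := hbdd x
    obtain ⟨K, hK⟩ := eventually_atTop.1 hb
    refine ⟨_, tendsto_atTop_ciSup (hmono x) ⟨b, ?_⟩⟩
    rintro _ ⟨k, rfl⟩
    exact (hmono x (le_max_left k K)).trans (hK _ (le_max_right _ _))
  choose l hl using hlim
  set B : Matrix ι ι ℝ := Matrix.of fun i j => (l (Pi.single i 1 + Pi.single j 1) -
    l (Pi.single i 1) - l (Pi.single j 1)) / 2
  have hB : Tendsto A atTop (𝓝 B) := by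
    refine tendsto_pi_nhds.2 fun i => tendsto_pi_nhds.2 fun j => ?_
    refine ((((hl _).sub (hl _)).sub (hl _)).div_const 2).congr fun k => ?_
    rw [matrix_entry_eq_quad (hA k)]
  refine ⟨B, ?_, hB⟩
  ext i j
  simp only [B, conjTranspose_apply, of_apply, star_trivial]
  rw [add_comm (Pi.single j 1 : ι → ℝ)]
  ring

end Quad

/-! ### The Riccati recursion in information form -/

section Riccati

variable {n : ℕ} {F Q : Matrix (Fin n) (Fin n) ℝ}

/-- One correction with the matrix `Θ` followed by one prediction. -/
def riccatiStep (F Q Θ P : Matrix (Fin n) (Fin n) ℝ) : Matrix (Fin n) (Fin n) ℝ :=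
  predict F Q (P⁻¹ + Θ)⁻¹

theorem predict_posDef (hQ : Q.PosDef) {P : Matrix (Fin n) (Fin n) ℝ} (hP : P.PosSemidef) :
    (predict F Q P).PosDef :=
  hQ.posSemidef_add (by simpa using hP.mul_mul_conjTranspose_same F)

theorem quad_predict (P : Matrix (Fin n) (Fin n) ℝ) (x : Fin n → ℝ) :
    quad (predict F Q P) x = quad P (Fᵀ *ᵥ x) + quad Q x := by
  rw [predict, quad_add, quad_conj]

theorem riccatiStep_posDef (hQ : Q.PosDef) {P Θ : Matrix (Fin n) (Fin n) ℝ} (hP : P.PosDef)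
    (hΘ : Θ.PosSemidef) : (riccatiStep F Q Θ P).PosDef :=
  predict_posDef hQ (hP.inv.add_posSemidef hΘ).inv.posSemidef

/-- The Riccati step contracts the Thompson metric, up to a deviation of the information rates. -/
theorem quad_riccatiStep_le {A B Θ Ξ : Matrix (Fin n) (Fin n) ℝ} (hA : A.PosDef) (hB : B.PosDef)
    (hΘ : Θ.PosSemidef) (hΞ : Ξ.PosSemidef) {t c : ℝ} (ht : 0 ≤ t)
    (h : ∀ x, quad A x ≤ (1 + t) * quad B x) (h' : ∀ x, quad Ξ x ≤ (1 + t) * quad Θ x)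
    (hc : ∀ x, c * quad (riccatiStep F Q Ξ B) x ≤ quad Q x) (x : Fin n → ℝ) :
    quad (riccatiStep F Q Θ A) x ≤ (1 + (1 - c) * t) * quad (riccatiStep F Q Ξ B) x := by
  have h1 := quad_corrected_le hA hB hΘ hΞ (by linarith) h h' (Fᵀ *ᵥ x)
  -- `Q` is not scaled by `1 + t`, which leaves a surplus `t Q`; this is at least `c t` times the
  -- new `B`.
  have h2 := mul_le_mul_of_nonneg_left (hc x) ht
  rw [riccatiStep, quad_predict]
  have h3 : quad (riccatiStep F Q Ξ B) x = quad (B⁻¹ + Ξ)⁻¹ (Fᵀ *ᵥ x) + quad Q x := by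
    rw [riccatiStep, quad_predict]
  linear_combination h1 + h2 - (1 + t) * h3

/-- Each step shrinks the excess factor by `1 - c`, until it reaches the level `ε` set by the error
in the rates. -/
theorem eventually_quad_le {A B Θ Ξ : ℕ → Matrix (Fin n) (Fin n) ℝ}
    (hA : ∀ k, (A k).PosDef) (hB : ∀ k, (B k).PosDef)
    (hΘ : ∀ k, (Θ k).PosSemidef) (hΞ : ∀ k, (Ξ k).PosSemidef)
    (hA' : ∀ k, A (k + 1) = riccatiStep F Q (Θ k) (A k))
    (hB' : ∀ k, B (k + 1) = riccatiStep F Q (Ξ k) (B k))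
    (hrate : ∀ ε : ℝ, 0 < ε → ∀ᶠ k in atTop, ∀ x, quad (Ξ k) x ≤ (1 + ε) * quad (Θ k) x)
    {c : ℝ} (hc0 : 0 < c) (hc : ∀ᶠ k in atTop, ∀ x, c * quad (B k) x ≤ quad Q x)
    {ε : ℝ} (hε : 0 < ε) :
    ∀ᶠ k in atTop, ∀ x, quad (A k) x ≤ (1 + ε) * quad (B k) x := by
  -- This keeps `1 - c` nonnegative, as the geometric bound requires.
  wlog hc1 : c ≤ 1 generalizing c
  · refine this one_pos ?_ le_rfl
    filter_upwards [hc] with k hk x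
    exact (mul_le_mul_of_nonneg_right (not_le.1 hc1).le
      ((hB k).posSemidef.quad_nonneg x)).trans (hk x)
  obtain ⟨K, hK⟩ := eventually_atTop.1 ((hrate ε hε).and hc)
  obtain ⟨T, hT0, hT⟩ := (hB K).exists_mul_quad_le (A K)
  have key : ∀ j x, quad (A (K + j)) x ≤ (1 + max ε ((1 - c) ^ j * T)) * quad (B (K + j)) x := by
    intro j
    induction j with
    | zero =>
      intro x
      refine (hT x).trans (mul_le_mul_of_nonneg_right ?_ ((hB _).posSemidef.quad_nonneg x))
      have := le_max_right ε ((1 - c) ^ 0 * T)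
      rw [pow_zero, one_mul] at this ⊢
      linarith
    | succ j ih =>
      intro x
      rw [← add_assoc, hA', hB']
      refine (quad_riccatiStep_le (c := c) (hA _) (hB _) (hΘ _) (hΞ _) (le_max_of_le_left hε.le) ih
        (fun y => ((hK (K + j) (by omega)).1 y).trans (mul_le_mul_of_nonneg_right
          (add_le_add_right (le_max_left _ _) _) ((hΘ _).quad_nonneg y)))
        (fun y => ?_) x).trans ?_
      · rw [← hB']
        exact (hK (K + j + 1) (by omega)).2 y
      · rw [← hB']
        refine mul_le_mul_of_nonneg_right (add_le_add_right ?_ _)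
          ((hB _).posSemidef.quad_nonneg x)
        rw [mul_max_of_nonneg _ _ (by linarith), pow_succ', mul_assoc]
        exact max_le_max_right _ (by nlinarith)
  have hlim : Tendsto (fun j : ℕ => (1 - c) ^ j * T) atTop (𝓝 0) := by
    simpa using (tendsto_pow_atTop_nhds_zero_of_lt_one (by linarith) (by linarith)).mul_const T
  obtain ⟨J, hJ⟩ := eventually_atTop.1 (hlim.eventually (eventually_le_nhds hε))
  refine eventually_atTop.2 ⟨K + J, fun k hk x => ?_⟩
  obtain ⟨j, rfl⟩ := Nat.exists_eq_add_of_le (le_trans (Nat.le_add_right K J) hk)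
  have := key j x
  rwa [max_eq_left (hJ j (by omega))] at this

/-- Convergence of the Riccati recursion with converging information rates to any positive
definite fixed point of the limiting recursion. -/
theorem tendsto_riccati (hQ : Q.PosDef) {S Pstar : Matrix (Fin n) (Fin n) ℝ} (hS : S.PosSemidef)
    (hP : Pstar.PosDef) (hfix : riccatiStep F Q S Pstar = Pstar)
    {A Θ : ℕ → Matrix (Fin n) (Fin n) ℝ} (hA : ∀ k, (A k).PosDef) (hΘ : ∀ k, (Θ k).PosSemidef)
    (hA' : ∀ k, A (k + 1) = riccatiStep F Q (Θ k) (A k))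
    (hrate : ∀ ε : ℝ, 0 < ε → ∀ᶠ k in atTop, ∀ x, quad S x ≤ (1 + ε) * quad (Θ k) x)
    (hrate' : ∀ ε : ℝ, 0 < ε → ∀ᶠ k in atTop, ∀ x, quad (Θ k) x ≤ (1 + ε) * quad S x) :
    Tendsto A atTop (𝓝 Pstar) := by
  obtain ⟨b, hb0, hb⟩ := hQ.exists_mul_quad_le Pstar
  have hup : ∀ ε : ℝ, 0 < ε → ∀ᶠ k in atTop, ∀ x, quad (A k) x ≤ (1 + ε) * quad Pstar x := by
    intro ε hε
    refine eventually_quad_le (B := fun _ => Pstar) (Ξ := fun _ => S) hA (fun _ => hP) hΘ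
      (fun _ => hS) hA' (fun _ => hfix.symm) hrate (inv_pos.2 hb0) (.of_forall fun _ x => ?_) hε
    rw [inv_mul_le_iff₀ hb0]
    exact hb x
  -- Here the sequence `A` itself must be dominated by `Q`: the upper bound with `ε = 1` gives `A ≤
  -- 2 Pstar ≤ 2 b Q`.
  have hlow : ∀ ε : ℝ, 0 < ε → ∀ᶠ k in atTop, ∀ x, quad Pstar x ≤ (1 + ε) * quad (A k) x := by
    intro ε hε
    refine eventually_quad_le (A := fun _ => Pstar) (Θ := fun _ => S) (fun _ => hP) hA
      (fun _ => hS) hΘ (fun _ => hfix.symm) hA' hrate' (c := (2 * b)⁻¹) (by positivity) ?_ hε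
    filter_upwards [hup 1 one_pos] with k hk x
    rw [inv_mul_le_iff₀ (by positivity)]
    linarith [hk x, hb x]
  refine tendsto_of_tendsto_quad (.of_forall fun k => (hA k).1) hP.1 fun x => ?_
  have hx := hP.posSemidef.quad_nonneg x
  refine Metric.tendsto_nhds.2 fun δ hδ => ?_
  set ε := δ / (2 * (quad Pstar x + 1))
  have hε : 0 < ε := by positivity
  have hεδ : ε * quad Pstar x < δ := by
    have h : ε * (2 * (quad Pstar x + 1)) = δ := div_mul_cancel₀ _ (by positivity)
    nlinarith
  filter_upwards [hup ε hε, hlow ε hε] with k h1 h2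
  have h3 := h1 x
  have h4 := h2 x
  rw [Real.dist_eq, abs_lt]
  constructor
  · by_contra! h5
    nlinarith
  · linarith

end Riccati

/-! ### The positive definite solution of the algebraic Riccati equation -/

/-- Observability is controllability of the dual system. -/
theorem Observable.exists_control {n : ℕ} {F : Matrix (Fin n) (Fin n) ℝ} {p : Type*}
    [Fintype p] {C : Matrix p (Fin n) ℝ}
    (h : Observable F C) (y : Fin n → ℝ) :
    ∃ u : ℕ → p → ℝ, y = ∑ i ∈ Finset.range n, (Fᵀ ^ i) *ᵥ (Cᵀ *ᵥ u i) := by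
  have hsurj : Function.Surjective (observabilityMatrix F C)ᵀ.mulVecLin := by
    rw [← LinearMap.range_eq_top]
    apply Submodule.eq_top_of_finrank_eq
    have h1 : (observabilityMatrix F C)ᵀ.rank = n := by rw [rank_transpose]; exact h
    rw [Module.finrank_fin_fun]
    exact h1
  obtain ⟨w, hw⟩ := hsurj y
  refine ⟨fun i q => if hi : i < n then w (⟨i, hi⟩, q) else 0, ?_⟩
  rw [Finset.sum_range, ← hw]
  ext b
  rw [mulVecLin_apply, mulVec, dotProduct, Fintype.sum_prod_type, Finset.sum_apply]
  refine Finset.sum_congr rfl fun i _ => ?_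
  have h2 := congrFun (mulVec_mulVec (fun q => w (i, q)) (Fᵀ ^ (i : ℕ)) Cᵀ) b
  simp only [Fin.is_lt, dite_true, Fin.eta]
  rw [h2, ← transpose_pow, ← transpose_mul]
  rfl

section Existence

variable {n : ℕ} {F Q : Matrix (Fin n) (Fin n) ℝ} {p : Type*} [Fintype p] [DecidableEq p]
  {C : Matrix p (Fin n) ℝ} {R : Matrix p p ℝ}

theorem transpose_mul_inv_mul_posSemidef (C : Matrix p (Fin n) ℝ) (hR : R.PosDef) :
    (Cᵀ * R⁻¹ * C).PosSemidef := by
  simpa using hR.inv.posSemidef.conjTranspose_mul_mul_same C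

/-- The Woodbury identity converts the covariance form of the correction into the information form.
-/
theorem solvesDARE_iff {P : Matrix (Fin n) (Fin n) ℝ} (hR : R.PosDef) (hP : P.PosDef) :
    SolvesDARE F Q C R P ↔ riccatiStep F Q (Cᵀ * R⁻¹ * C) P = P := by
  have h : (P⁻¹ + Cᵀ * R⁻¹ * C)⁻¹ = P - P * Cᵀ * (C * P * Cᵀ + R)⁻¹ * C * P := by
    rw [add_mul_mul_inv_eq_sub _ _ _ _ hP.inv.isUnit hR.inv.isUnit, hP.inv_inv, hR.inv_inv,
      add_comm R]
    rw [hP.inv_inv, hR.inv_inv]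
    refine (hR.add_posSemidef ?_).isUnit
    simpa using hP.posSemidef.mul_mul_conjTranspose_same C
  rw [SolvesDARE, riccatiStep, predict, h, eq_comm]

/-- The corrected covariance is at most the covariance of any linear estimator. -/
theorem quad_corrected_le_add {P : Matrix (Fin n) (Fin n) ℝ} (hR : R.PosDef) (hP : P.PosDef)
    (z : Fin n → ℝ) (u : p → ℝ) :
    quad (P⁻¹ + Cᵀ * R⁻¹ * C)⁻¹ (z + Cᵀ *ᵥ u) ≤ quad P z + quad R u := by
  have hA := hP.inv.add_posSemidef (transpose_mul_inv_mul_posSemidef C hR)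
  set A := P⁻¹ + Cᵀ * R⁻¹ * C with hAdef
  -- At this `w` the Fenchel inequality for `A` is an equality; applying it separately to `P` and
  -- `R` bounds the two halves.
  set w := A⁻¹ *ᵥ (z + Cᵀ *ᵥ u) with hw
  have h1 := hP.two_mul_dotProduct_le w z
  have h2 := hR.two_mul_dotProduct_le (C *ᵥ w) u
  have h3 : quad (Cᵀ * R⁻¹ * C) w = quad R⁻¹ (C *ᵥ w) := by
    simpa using quad_conj R⁻¹ Cᵀ w
  have h4 : quad A w = quad P⁻¹ w + quad R⁻¹ (C *ᵥ w) := by rw [hAdef, quad_add, h3]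
  have h5 : quad A w = w ⬝ᵥ z + (C *ᵥ w) ⬝ᵥ u := by
    rw [quad, hw, hA.mulVec_inv_mulVec, ← hw, dotProduct_add, dotProduct_mulVec, vecMul_transpose]
  have h6 : quad A⁻¹ (z + Cᵀ *ᵥ u) = quad A w := by
    rw [quad, quad, ← hw, hw, hA.mulVec_inv_mulVec, dotProduct_comm]
  linarith

theorem iterate_riccatiStep_posDef (hQ : Q.PosDef) {S P : Matrix (Fin n) (Fin n) ℝ}
    (hS : S.PosSemidef) (hP : P.PosDef) (k : ℕ) : ((riccatiStep F Q S)^[k] P).PosDef := by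
  induction k with
  | zero => exact hP
  | succ k ih =>
    rw [Function.iterate_succ_apply']
    exact riccatiStep_posDef hQ ih hS

/-- A control that steers the dual system from `x` to the origin bounds the Riccati recursion,
uniformly in its initial value. -/
theorem exists_quad_iterate_riccatiStep_le (hQ : Q.PosDef) (hR : R.PosDef) (u : ℕ → p → ℝ)
    (j : ℕ) (x : Fin n → ℝ)
    (hx : (Fᵀ ^ j) *ᵥ x = ∑ i ∈ Finset.range j, (Fᵀ ^ i) *ᵥ (Cᵀ *ᵥ u i)) :
    ∃ b, ∀ P : Matrix (Fin n) (Fin n) ℝ, P.PosDef →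
      quad ((riccatiStep F Q (Cᵀ * R⁻¹ * C))^[j] P) x ≤ b := by
  induction j generalizing x with
  | zero =>
    have hx0 : x = 0 := by simpa using hx
    exact ⟨0, fun P _ => by simp [hx0, quad]⟩
  | succ j ih =>
    -- The last correction spends `u j`; the remainder is steered to the origin by the controls with
    -- indices below `j`.
    obtain ⟨b, hb⟩ := ih (Fᵀ *ᵥ x - Cᵀ *ᵥ u j) (by
      rw [mulVec_sub, mulVec_mulVec, ← pow_succ, hx, Finset.sum_range_succ, add_sub_cancel_right])
    refine ⟨b + quad R (u j) + quad Q x, fun P hP => ?_⟩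
    have hPj := iterate_riccatiStep_posDef (F := F) hQ
      (transpose_mul_inv_mul_posSemidef C hR) hP j
    have h1 := quad_corrected_le_add (C := C) hR hPj (Fᵀ *ᵥ x - Cᵀ *ᵥ u j) (u j)
    rw [sub_add_cancel] at h1
    rw [Function.iterate_succ_apply', riccatiStep, quad_predict]
    linarith [hb P hP]

theorem exists_riccatiStep_fixedPoint (hQ : Q.PosDef) (hR : R.PosDef) (h : Observable F C) :
    ∃ P : Matrix (Fin n) (Fin n) ℝ, P.PosDef ∧ riccatiStep F Q (Cᵀ * R⁻¹ * C) P = P := by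
  set S := Cᵀ * R⁻¹ * C with hSdef
  have hS : S.PosSemidef := transpose_mul_inv_mul_posSemidef C hR
  -- Starting at `Q` makes the first step an increase; monotonicity of the Riccati step propagates
  -- it.
  set P : ℕ → Matrix (Fin n) (Fin n) ℝ := fun k => (riccatiStep F Q S)^[k] Q
  have hstep : ∀ k, P (k + 1) = riccatiStep F Q S (P k) := fun k =>
    Function.iterate_succ_apply' _ _ _
  have hP : ∀ k, (P k).PosDef := iterate_riccatiStep_posDef hQ hS hQ
  have hmono : ∀ k x, quad (P k) x ≤ quad (P (k + 1)) x := by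
    intro k
    induction k with
    | zero =>
      intro x
      rw [hstep, riccatiStep, quad_predict]
      have := ((hP 0).inv.add_posSemidef hS).inv.posSemidef.quad_nonneg (Fᵀ *ᵥ x)
      change quad Q x ≤ _
      linarith
    | succ k ih =>
      intro x
      rw [hstep, hstep (k + 1), riccatiStep, riccatiStep, quad_predict, quad_predict]
      have := quad_corrected_le (hP k) (hP (k + 1)) hS hS one_pos
        (fun y => by rw [one_mul]; exact ih y) (fun y => by rw [one_mul]) (Fᵀ *ᵥ x)
      linarith
  have hmono' : ∀ x, Monotone fun k => quad (P k) x := fun x =>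
    monotone_nat_of_le_succ fun k => hmono k x
  obtain ⟨B, hBherm, hB⟩ := exists_tendsto_of_quad_monotone (fun k => (hP k).1) hmono' (by
    intro x
    obtain ⟨u, hu⟩ := h.exists_control ((Fᵀ ^ n) *ᵥ x)
    obtain ⟨b, hb⟩ := exists_quad_iterate_riccatiStep_le hQ hR u n x hu
    refine ⟨b, eventually_atTop.2 ⟨n, fun k hk => ?_⟩⟩
    -- The bound is uniform in the initial value, so only the last `n` steps matter.
    have hk' : P k = (riccatiStep F Q S)^[n] (P (k - n)) := by
      simp only [P]
      rw [← Function.iterate_add_apply, Nat.add_sub_cancel' hk]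
    rw [hk']
    exact hb _ (hP _))
  have hBpd : B.PosDef := by
    refine PosDef.of_dotProduct_mulVec_pos hBherm fun x hx => ?_
    have h1 : Tendsto (fun k => quad (P k) x) atTop (𝓝 (quad B x)) := by
      have hc : Continuous fun A : Matrix (Fin n) (Fin n) ℝ => quad A x :=
        continuous_const.dotProduct (continuous_id.matrix_mulVec continuous_const)
      exact (hc.tendsto B).comp hB
    have h2 : quad Q x ≤ quad B x :=
      ge_of_tendsto' h1 fun k => hmono' x (Nat.zero_le k)
    rw [star_trivial]
    exact (hQ.quad_pos hx).trans_le h2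
  refine ⟨B, hBpd, tendsto_nhds_unique ?_ (hB.comp (tendsto_add_atTop_nat 1))⟩
  have h1 := tendsto_matrix_inv ((tendsto_matrix_inv hB hBpd.isUnit).add_const S)
    (hBpd.inv.add_posSemidef hS).isUnit
  have hc : Continuous (predict F Q) :=
    ((continuous_const.matrix_mul continuous_id).matrix_mul continuous_const).add
      continuous_const
  exact ((hc.tendsto _).comp h1).congr fun k => (hstep k).symm

end Existence

/-! ### The information rates -/

section InfoRate

variable {n N : ℕ} {m : Fin N → ℕ} {H : (i : Fin N) → Matrix (Fin (m i)) (Fin n) ℝ}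
  {R : (i : Fin N) → Matrix (Fin (m i)) (Fin (m i)) ℝ}

theorem posDef_of_blockDiagonal' (hR : (blockDiagonal' R).PosDef) (i : Fin N) :
    (R i).PosDef := by
  have h := hR.submatrix (e := Sigma.mk i) sigma_mk_injective
  convert h using 1
  ext p q
  rw [submatrix_apply, blockDiagonal'_apply_eq]

theorem stack_information (hR : ∀ i, (R i).PosDef) :
    (stack H)ᵀ * (blockDiagonal' R)⁻¹ * stack H = ∑ i, (H i)ᵀ * (R i)⁻¹ * H i := by
  have hinv : (blockDiagonal' R)⁻¹ = blockDiagonal' fun i => (R i)⁻¹ := by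
    apply inv_eq_right_inv
    rw [← blockDiagonal'_mul, ← blockDiagonal'_one]
    congr 1
    ext1 i
    exact mul_nonsing_inv _ ((isUnit_iff_isUnit_det _).1 (hR i).isUnit)
  have hmul : ∀ (i : Fin N) (q : Fin (m i)) (c : Fin n),
      (blockDiagonal' (fun i => (R i)⁻¹) * stack H) ⟨i, q⟩ c = ((R i)⁻¹ * H i) q c := by
    intro i q c
    rw [mul_apply, Fintype.sum_sigma, Finset.sum_eq_single i]
    · simp only [blockDiagonal'_apply_eq, mul_apply]
      rfl
    · intro j _ hj
      exact Finset.sum_eq_zero fun r _ => by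
        rw [blockDiagonal'_apply_ne _ _ _ hj.symm, zero_mul]
    · simp
  rw [hinv, Matrix.mul_assoc]
  ext b c
  rw [mul_apply, Fintype.sum_sigma, Matrix.sum_apply]
  refine Finset.sum_congr rfl fun i _ => ?_
  rw [Matrix.mul_assoc, mul_apply]
  refine Finset.sum_congr rfl fun q _ => ?_
  rw [hmul]
  rfl

variable {G : SimpleGraph (Fin N)} [DecidableRel G.Adj] {a : Matrix (Fin N) (Fin N) ℝ}

/-- Consensus acts entrywise, and symmetry of the local matrices makes `invVech` recover them in
full. -/
theorem IsNetwork.infoRate_eq (h : IsNetwork G a) (hR : ∀ i, (R i).PosDef) (α : Fin N → ℝ)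
    {lstar k l : ℕ} (hl : k * lstar = l + 1) (i : Fin N) :
    infoRate H R G a α lstar i k =
      ∑ j, consensusCoeff a α l i j • ((H j)ᵀ * (R j)⁻¹ * H j) := by
  ext b c
  have h1 := congrFun (h.iterate_subiteration_primal α (localRate H R) l
    ⟨(min b c, max b c), min_le_max⟩) i
  rw [infoRate, consensusState_eq_iterate, hl, invVech, of_apply, h1, Matrix.sum_apply, mulVec,
    dotProduct]
  refine Finset.sum_congr rfl fun j _ => ?_
  rw [Matrix.smul_apply, smul_eq_mul, localRate, vech]
  congr 1
  change ((H j)ᵀ * (R j)⁻¹ * H j) (min b c) (max b c) = _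
  rcases le_total b c with hbc | hbc
  · rw [min_eq_left hbc, max_eq_right hbc]
  · rw [min_eq_right hbc, max_eq_left hbc]
    have hsymm := (transpose_mul_inv_mul_posSemidef (H j) (hR j)).1.apply b c
    simpa using hsymm

end InfoRate

/-! ### Convergence of the predicted covariances -/

section Convergence

variable {n N : ℕ} {F Q : Matrix (Fin n) (Fin n) ℝ}

theorem corrCov_posDef (hQ : Q.PosDef) {Θ : ℕ → Matrix (Fin n) (Fin n) ℝ}
    (hΘ : ∀ k, 1 ≤ k → (Θ k).PosSemidef) {P₀ : Matrix (Fin n) (Fin n) ℝ} (hP₀ : P₀.PosDef)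
    (k : ℕ) : (corrCov F Q Θ P₀ k).PosDef := by
  induction k with
  | zero => exact hP₀
  | succ k ih =>
    exact ((predict_posDef hQ ih.posSemidef).inv.add_posSemidef (hΘ _ (Nat.succ_pos k))).inv

theorem tendsto_predCov (hQ : Q.PosDef) {W : Fin N → Matrix (Fin n) (Fin n) ℝ}
    (hW : ∀ j, (W j).PosSemidef) {Pstar : Matrix (Fin n) (Fin n) ℝ} (hP : Pstar.PosDef)
    (hfix : riccatiStep F Q (∑ j, W j) Pstar = Pstar) {Θ : ℕ → Matrix (Fin n) (Fin n) ℝ}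
    {c : ℕ → Fin N → ℝ} (hc : ∀ j, Tendsto (fun k => c k j) atTop (𝓝 1))
    (hΘ : ∀ᶠ k in atTop, Θ k = ∑ j, c k j • W j) {P₀ : Matrix (Fin n) (Fin n) ℝ}
    (hP₀ : P₀.PosDef) (hpd : ∀ k, 1 ≤ k → (corrCov F Q Θ P₀ k).PosDef) :
    Tendsto (predCov F Q Θ P₀) atTop (𝓝 Pstar) := by
  have hpd' : ∀ k, (corrCov F Q Θ P₀ k).PosDef := fun k =>
    k.eq_zero_or_pos.elim (fun h => h ▸ hP₀) (hpd k)
  have hpos : ∀ᶠ k in atTop, (Θ k).PosSemidef := by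
    filter_upwards [hΘ, eventually_all.2 fun j => (hc j).eventually (eventually_ge_nhds one_pos)]
      with k hk hck
    rw [hk]
    exact posSemidef_sum _ fun j _ => (hW j).smul (hck j)
  obtain ⟨K, hK⟩ := eventually_atTop.1 hpos
  have hshift : Tendsto (fun k => k + K + 1) atTop atTop :=
    (tendsto_add_atTop_nat 1).comp (tendsto_add_atTop_nat K)
  -- Early rates may be indefinite, so the recursion is restarted at time `K`, from whatever
  -- positive definite covariance it has reached.
  rw [← tendsto_add_atTop_iff_nat K]
  refine tendsto_riccati (Θ := fun k => Θ (k + K + 1)) hQ (posSemidef_sum _ fun j _ => hW j) hP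
    hfix (fun k => predict_posDef hQ (hpd' _).posSemidef) (fun k => hK _ (by omega))
    (fun k => ?_) (fun ε hε => hshift.eventually
      (p := fun k => ∀ x, quad (∑ j, W j) x ≤ (1 + ε) * quad (Θ k) x) ?_)
    (fun ε hε => hshift.eventually
      (p := fun k => ∀ x, quad (Θ k) x ≤ (1 + ε) * quad (∑ j, W j) x) ?_)
  · rw [Nat.add_right_comm]
    rfl
  · have h1 : (1 + ε)⁻¹ < 1 := inv_lt_one_of_one_lt₀ (by linarith)
    filter_upwards [hΘ, eventually_all.2 fun j => (hc j).eventually (eventually_ge_nhds h1)]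
      with k hk hck x
    rw [hk, quad_sum, quad_sum, Finset.mul_sum]
    refine Finset.sum_le_sum fun j _ => ?_
    rw [quad_smul, ← mul_assoc]
    have h2 : 1 ≤ (1 + ε) * c k j := (inv_le_iff_one_le_mul₀' (by linarith)).1 (hck j)
    exact le_mul_of_one_le_left ((hW j).quad_nonneg x) h2
  · have h1 : (1 : ℝ) < 1 + ε := by linarith
    filter_upwards [hΘ, eventually_all.2 fun j => (hc j).eventually (eventually_le_nhds h1)]
      with k hk hck x
    rw [hk, quad_sum, quad_sum, Finset.mul_sum]
    refine Finset.sum_le_sum fun j _ => ?_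
    rw [quad_smul]
    exact mul_le_mul_of_nonneg_right (hck j) ((hW j).quad_nonneg x)

end Convergence

end DADKF

end

/-! ### Assembly of the main theorem -/

theorem mainTheorem1 {n N : ℕ} {m : Fin N → ℕ}
    -- the plant and the sensors
    (F Q : Matrix (Fin n) (Fin n) ℝ)
    (H : (i : Fin N) → Matrix (Fin (m i)) (Fin n) ℝ)
    (R : (i : Fin N) → Matrix (Fin (m i)) (Fin (m i)) ℝ)
    (hQ : Q.PosDef) (hR : (Matrix.blockDiagonal' R).PosDef)
    (hobs : DADKF.Observable F (DADKF.stack H))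
    -- the weighted, undirected, connected network and the bound on its Laplacian
    (G : SimpleGraph (Fin N)) [DecidableRel G.Adj] (a : Matrix (Fin N) (Fin N) ℝ)
    (ha_symm : a.IsSymm) (ha_pos : ∀ i j, G.Adj i j → 0 < a i j)
    (ha_zero : ∀ i j, ¬ G.Adj i j → a i j = 0) (hG : G.Connected)
    (σbar : ℝ)
    (hσ : ∀ μ : ℝ, Module.End.HasEigenvalue (Matrix.toLin' (DADKF.laplacian a)) μ → μ ≤ σbar)
    -- the gains
    (α : Fin N → ℝ) (hα : ∀ i, 0 < α i ∧ α i < 2 / σbar ^ 2) :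
    ∃ Pstar : Matrix (Fin n) (Fin n) ℝ,
      -- `Pstar` is the unique positive definite solution of the Riccati equation
      (Pstar.PosDef ∧
        DADKF.SolvesDARE F Q (DADKF.stack H) (Matrix.blockDiagonal' R) Pstar ∧
        ∀ P : Matrix (Fin n) (Fin n) ℝ, P.PosDef →
          DADKF.SolvesDARE F Q (DADKF.stack H) (Matrix.blockDiagonal' R) P → P = Pstar) ∧
      -- any number of subiterations: convergence at each node whose covariances stay
      -- positive definite
      (∀ lstar : ℕ, 1 ≤ lstar →
        ∀ P₀ : Fin N → Matrix (Fin n) (Fin n) ℝ, (∀ i, (P₀ i).PosDef) →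
        ∀ i : Fin N,
          (∀ k : ℕ, 1 ≤ k →
            (DADKF.corrCov F Q (DADKF.infoRate H R G a α lstar i) (P₀ i) k).PosDef) →
          Tendsto (DADKF.predCov F Q (DADKF.infoRate H R G a α lstar i) (P₀ i))
            atTop (𝓝 Pstar)) ∧
      -- sufficiently many subiterations: positive definiteness and convergence at every node
      (∃ lbar : ℕ, 1 ≤ lbar ∧ ∀ lstar : ℕ, lbar ≤ lstar →
        ∀ P₀ : Fin N → Matrix (Fin n) (Fin n) ℝ, (∀ i, (P₀ i).PosDef) →
        ∀ i : Fin N,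
          (∀ k : ℕ, 1 ≤ k →
            (DADKF.corrCov F Q (DADKF.infoRate H R G a α lstar i) (P₀ i) k).PosDef) ∧
          Tendsto (DADKF.predCov F Q (DADKF.infoRate H R G a α lstar i) (P₀ i))
            atTop (𝓝 Pstar)) ∧
      -- any number of subiterations, with exception handling: whenever `Θ_{i,k,l*}` is not positive
      -- semidefinite, some positive semidefinite matrix is used in its place
      (∀ lstar : ℕ, 1 ≤ lstar →
        ∀ P₀ : Fin N → Matrix (Fin n) (Fin n) ℝ, (∀ i, (P₀ i).PosDef) →
        ∀ Θ' : Fin N → ℕ → Matrix (Fin n) (Fin n) ℝ,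
          (∀ i k, 1 ≤ k → (Θ' i k).PosSemidef ∧
            ((DADKF.infoRate H R G a α lstar i k).PosSemidef →
              Θ' i k = DADKF.infoRate H R G a α lstar i k)) →
        ∀ i : Fin N,
          (∀ k : ℕ, 1 ≤ k → (DADKF.corrCov F Q (Θ' i) (P₀ i) k).PosDef) ∧
          Tendsto (DADKF.predCov F Q (Θ' i) (P₀ i)) atTop (𝓝 Pstar)) := by
  have hnet : DADKF.IsNetwork G a := ⟨ha_symm, ha_pos, ha_zero, hG⟩
  have hRi := DADKF.posDef_of_blockDiagonal' hR
  set W := fun j => (H j)ᵀ * (R j)⁻¹ * H j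
  have hW : ∀ j, (W j).PosSemidef := fun j =>
    DADKF.transpose_mul_inv_mul_posSemidef (H j) (hRi j)
  have hdare : ∀ P : Matrix (Fin n) (Fin n) ℝ, P.PosDef →
      (DADKF.SolvesDARE F Q (DADKF.stack H) (Matrix.blockDiagonal' R) P ↔
        DADKF.riccatiStep F Q (∑ j, W j) P = P) := by
    intro P hP
    rw [DADKF.solvesDARE_iff hR hP, DADKF.stack_information hRi]
  obtain ⟨Pstar, hPstar, hfix⟩ := DADKF.exists_riccatiStep_fixedPoint hQ hR hobs
  rw [DADKF.stack_information hRi] at hfix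
  -- the coefficients of the information rates with respect to the local ones
  set c : ℕ → Fin N → Fin N → ℝ := fun l i j => DADKF.consensusCoeff a α (l - 1) i j
  -- The truncated `l - 1` at `l = 0` is harmless: the rates are used only for `k * lstar ≥ 1`.
  have hc : ∀ i j, Tendsto (fun l => c l i j) atTop (𝓝 1) := fun i j =>
    (hnet.tendsto_consensusCoeff hα hσ i j).comp (tendsto_sub_atTop_nat 1)
  have hrate : ∀ lstar k : ℕ, 1 ≤ lstar → 1 ≤ k → ∀ i,
      DADKF.infoRate H R G a α lstar i k = ∑ j, c (k * lstar) i j • W j := fun lstar k hl hk i =>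
    hnet.infoRate_eq hRi α (Nat.sub_add_cancel (Nat.mul_pos hk hl)).symm i
  have hmul : ∀ lstar : ℕ, 1 ≤ lstar → Tendsto (fun k => k * lstar) atTop atTop :=
    fun lstar hl => tendsto_id.atTop_mul_const' hl
  have hcpos : ∀ᶠ l in atTop, ∀ i j, 0 ≤ c l i j :=
    eventually_all.2 fun i => eventually_all.2 fun j =>
      (hc i j).eventually (eventually_ge_nhds one_pos)
  have hpos : ∀ lstar k : ℕ, 1 ≤ lstar → 1 ≤ k → (∀ i j, 0 ≤ c (k * lstar) i j) → ∀ i,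
      (DADKF.infoRate H R G a α lstar i k).PosSemidef := by
    intro lstar k hl hk h i
    rw [hrate lstar k hl hk]
    exact Matrix.posSemidef_sum _ fun j _ => (hW j).smul (h i j)
  have hconv : ∀ lstar : ℕ, 1 ≤ lstar → ∀ (P₀ : Matrix (Fin n) (Fin n) ℝ), P₀.PosDef →
      ∀ (i : Fin N) (Θ : ℕ → Matrix (Fin n) (Fin n) ℝ),
      (∀ᶠ k in atTop, Θ k = DADKF.infoRate H R G a α lstar i k) →
      (∀ k : ℕ, 1 ≤ k → (DADKF.corrCov F Q Θ P₀ k).PosDef) →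
      Tendsto (DADKF.predCov F Q Θ P₀) atTop (𝓝 Pstar) := by
    intro lstar hl P₀ hP₀ i Θ hΘ hpd
    refine DADKF.tendsto_predCov hQ hW hPstar hfix (c := fun k => c (k * lstar) i)
      (fun j => (hc i j).comp (hmul lstar hl)) ?_ hP₀ hpd
    filter_upwards [hΘ, eventually_ge_atTop 1] with k hk hk1
    rw [hk, hrate lstar k hl hk1]
  refine ⟨Pstar, ⟨hPstar, (hdare _ hPstar).2 hfix, fun P hP hsol => ?_⟩, ?_, ?_, ?_⟩
  -- Another solution is a constant Riccati trajectory, so it converges to `Pstar`.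
  · refine tendsto_nhds_unique tendsto_const_nhds (DADKF.tendsto_riccati
      (A := fun _ => P) (Θ := fun _ => ∑ j, W j) hQ (Matrix.posSemidef_sum _ fun j _ => hW j)
      hPstar hfix (fun _ => hP) (fun _ => Matrix.posSemidef_sum _ fun j _ => hW j)
      (fun _ => ((hdare P hP).1 hsol).symm) ?_ ?_)
    all_goals
      exact fun ε hε => .of_forall fun _ x => le_mul_of_one_le_left
        ((Matrix.posSemidef_sum _ fun j _ => hW j).quad_nonneg x) (by linarith)
  · exact fun lstar hl P₀ hP₀ i hpd => hconv lstar hl _ (hP₀ i) i _ (.of_forall fun _ => rfl) hpd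
  · obtain ⟨L, hL⟩ := eventually_atTop.1 hcpos
    -- Since `k * lstar ≥ lstar > L` for `k ≥ 1`, the coefficients are nonnegative from the first
    -- time step on.
    refine ⟨L + 1, Nat.succ_pos L, fun lstar hl P₀ hP₀ i => ?_⟩
    have hl1 : 1 ≤ lstar := (Nat.succ_pos L).trans_le hl
    have hpd : ∀ k : ℕ, 1 ≤ k →
        (DADKF.corrCov F Q (DADKF.infoRate H R G a α lstar i) (P₀ i) k).PosDef := fun k _ =>
      DADKF.corrCov_posDef hQ (fun k hk => hpos lstar k hl1 hk
        (hL _ (by nlinarith)) i) (hP₀ i) k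
    exact ⟨hpd, hconv lstar hl1 _ (hP₀ i) i _ (.of_forall fun _ => rfl) hpd⟩
  · intro lstar hl P₀ hP₀ Θ' hΘ' i
    have hpd : ∀ k : ℕ, 1 ≤ k → (DADKF.corrCov F Q (Θ' i) (P₀ i) k).PosDef := fun k _ =>
      DADKF.corrCov_posDef hQ (fun k hk => (hΘ' i k hk).1) (hP₀ i) k
    refine ⟨hpd, hconv lstar hl _ (hP₀ i) i _ ?_ hpd⟩
    -- Replacement can occur only finitely often, since the true rates are eventually positive
    -- semidefinite.
    filter_upwards [(hmul lstar hl).eventually hcpos, eventually_ge_atTop 1] with k hk hk1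
    exact (hΘ' i k hk1).2 (hpos lstar k hl hk1 hk i)
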